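/- Let $n\ge 0$ be an even integer, let $V=\mathbb Z_2^n$, and let $\mathcal H_V$ be the Hilbert space with orthonormal basis $\{|v\rangle : v\in V\}$. For a subspace $a\subseteq V$ let $a^\perp=\{v\in V: u\cdot v=0\ \forall u\in a\}$. Call $a$ a register subspace if it is spanned by a subset of the canonical basis vectors $e_1,\dots,e_n$. For every subspace $a$ of dimension $n/2$ fix a linear map $\mathbb Z_2^{n/2}\to V$, $t\mapsto t_a$, such that $t\mapsto t_a+a$ is an isomorphism $\mathbb Z_2^{n/2}\cong V/a$, and for $t,t'\in\mathbb Z_2^{n/2}$ let $$|a_{t,t'}\rangle=\frac1{\sqrt{|a|}}\sum_{u\in a}(-1)^{u\cdot t'_{a^\perp}}\,|u+t_a\rangle .$$ Let $A$ be a set of $n/2$-dimensional subspaces of $V$. In the $(n,A)$-leaky monogamy-of-entanglement game, Alice samples $a\in A$ and $t,t'\in\mathbb Z_2^{n/2}$ uniformly at random and sends $|a_{t,t'}\rangle$ to Bob and Charlie, who split it by a channel and are then isolated; Alice reveals $a$ to both; Bob guesses $t$, his guess is passed to Charlie, and Charlie then guesses $t'$; they win if both guesses are correct. Formally, a strategy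 $\mathtt S$ consists of two finite-dimensional systems $B$ and $C$, a completely positive trace-preserving map $\Phi$ from operators on $\mathcal H_V$ to operators on $\mathcal H_B\otimes\mathcal H_C$, a POVM $(B^a_t)_{t\in\mathbb Z_2^{n/2}}$ on $\mathcal H_B$ for every $a\in A$, and a POVM $(C^{a,t}_{t'})_{t'\in\mathbb Z_2^{n/2}}$ on $\mathcal H_C$ for every $a\in A$ and $t\in\mathbb Z_2^{n/2}$. Its winning probability is $$\mathfrak w_{n,A}(\mathtt S)=\mathop{\mathbb E}_{a\in A,\;t,t'\in\mathbb Z_2^{n/2}}\operatorname{Tr}\!\left[(B^a_t\otimes C^{a,t}_{t'})\,\Phi\big(|a_{t,t'}\rangle\langle a_{t,t'}|\big)\right],$$ where $\mathbb E$ is the uniform average, and the optimal winning probability is $\mathfrak w^*(n,A)=\sup_{\mathtt S}\mathfrak w_{n,A}(\mathtt S)$. Theorem. If $A$ is either the set of all register subspaces of $\mathbb Z_2^n$ of dimension $n/2$ or the set of all subspaces of $\mathbb Z_2^n$ of dimension $n/2$, then $$\mathfrak w^*(n,A)\le\sqrt e\,\Big(\cos\frac{\pi}{8}\Big)^n .$$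 -/

import Mathlib

universe u

noncomputable section

open scoped Kronecker BigOperators ComplexOrder

namespace LeakyMoE

/-- Bit strings of length `n`: the vector space `ℤ₂ⁿ`, which is also Alice's register `V`. -/
abbrev Bits (n : ℕ) : Type := Fin n → ZMod 2

/-- The linear operators on the Hilbert space with orthonormal basis indexed by the register `X`. -/
abbrev Op (X : Type*) : Type _ := Matrix X X ℂ

/-! ### Subspaces of bit strings -/

/-- The orthogonal subspace `a^⊥ = {v | u · v = 0 for all u ∈ a}`. -/
def perp {n : ℕ} (a : Submodule (ZMod 2) (Bits n)) : Submodule (ZMod 2) (Bits n) where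
  carrier := {v | ∀ u ∈ a, u ⬝ᵥ v = 0}
  add_mem' := by
    intro v w hv hw u hu
    rw [dotProduct_add, hv u hu, hw u hu, add_zero]
  zero_mem' := by
    intro u _
    exact dotProduct_zero u
  smul_mem' := by
    intro c v hv u hu
    rw [dotProduct_smul, hv u hu, smul_zero]

/-- A register subspace is the span of a set of canonical basis vectors. -/
def IsRegisterSubspace {n : ℕ} (a : Submodule (ZMod 2) (Bits n)) : Prop :=
  ∃ S : Set (Fin n),
    a = Submodule.span (ZMod 2) ((fun i => (Pi.single i 1 : Bits n)) '' S)

/-- All subspaces of `ℤ₂ⁿ` of dimension `n / 2`. -/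
def halfSubspaces (n : ℕ) : Finset (Submodule (ZMod 2) (Bits n)) :=
  (Set.toFinite {a : Submodule (ZMod 2) (Bits n) |
    Module.finrank (ZMod 2) a = n / 2}).toFinset

/-- All register subspaces of `ℤ₂ⁿ` of dimension `n / 2`. -/
def registerHalfSubspaces (n : ℕ) : Finset (Submodule (ZMod 2) (Bits n)) :=
  (Set.toFinite {a : Submodule (ZMod 2) (Bits n) |
    IsRegisterSubspace a ∧ Module.finrank (ZMod 2) a = n / 2}).toFinset

/-! ### Coset states -/

open Classical in
/-- The subspace coset state `|a_{t,t'}⟩ = |a|^{-1/2} ∑_{u ∈ a} (-1)^{u · t'} |u + t⟩`, as the vector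
of its coefficients in the register basis. -/
def cosetState {n : ℕ} (a : Submodule (ZMod 2) (Bits n)) (t t' : Bits n) : Bits n → ℂ :=
  ((1 / Real.sqrt (Nat.card a) : ℝ) : ℂ) •
    ∑ u ∈ Finset.univ.filter (fun u : Bits n => u ∈ a),
      ((-1 : ℂ) ^ (u ⬝ᵥ t').val) • (Pi.single (u + t) 1 : Bits n → ℂ)

/-- The rank-one operator `|ψ⟩⟨ψ|`. -/
def ketbra {X : Type*} (ψ : X → ℂ) : Op X := Matrix.vecMulVec ψ (star ψ)

/-- `r` fixes, for every subspace `a` of dimension `n / 2`, a linear map `t ↦ t_a = r a t` from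
`ℤ₂^{n/2}` to `ℤ₂ⁿ` such that `t ↦ t_a + a` is an isomorphism `ℤ₂^{n/2} ≅ ℤ₂ⁿ / a`
(for even `n`; values of `r` at subspaces of other dimensions are irrelevant). -/
def IsCosetLabelling {n : ℕ}
    (r : Submodule (ZMod 2) (Bits n) → (Bits (n / 2) →ₗ[ZMod 2] Bits n)) : Prop :=
  ∀ a : Submodule (ZMod 2) (Bits n), Module.finrank (ZMod 2) a = n / 2 →
    Function.Bijective (a.mkQ ∘ₗ r a)

/-- For `t, t' ∈ ℤ₂^{n/2}`, the coset state `|a_{t,t'}⟩` with shifts `t_a` and `t'_{a^⊥}`. -/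
def labelledCosetState {n : ℕ}
    (r : Submodule (ZMod 2) (Bits n) → (Bits (n / 2) →ₗ[ZMod 2] Bits n))
    (a : Submodule (ZMod 2) (Bits n)) (t t' : Bits (n / 2)) : Bits n → ℂ :=
  cosetState a (r a t) (r (perp a) t')

/-! ### Measurements and channels -/

/-- Positive operator-valued measurements on the register `X` with outcomes in `S`. -/
structure IsPOVM {S X : Type*} [Fintype S] [DecidableEq X] (P : S → Op X) : Prop where
  posSemidef : ∀ s, (P s).PosSemidef
  sum_eq_one : ∑ s, P s = 1

/-- The operator `(id_Z ⊗ Φ)(P)`: apply `Φ` to each `X`-block of `P`. -/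
def ampliate {X Y : Type*} (Z : Type*) (Φ : Op X →ₗ[ℂ] Op Y) (P : Op (Z × X)) : Op (Z × Y) :=
  Matrix.of fun p q => Φ (Matrix.of fun x x' => P (p.1, x) (q.1, x')) p.2 q.2

/-- Quantum channels: completely positive trace-preserving linear maps. -/
structure IsChannel {X Y : Type*} [Fintype X] [Fintype Y] (Φ : Op X →ₗ[ℂ] Op Y) : Prop where
  completelyPositive : ∀ (Z : Type) [Fintype Z] (P : Op (Z × X)),
    P.PosSemidef → (ampliate Z Φ P).PosSemidef
  tracePreserving : ∀ P : Op X, (Φ P).trace = P.trace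

/-! ### The leaky monogamy-of-entanglement game -/

/-- A quantum strategy for the leaky monogamy-of-entanglement game on the set `A` of subspaces:
finite registers `B`, `C`, a splitting channel, Bob's measurements `B^a` and Charlie's measurements
`C^{a,t}`, where `t` is the guess of Bob that is passed to Charlie. -/
structure Strategy (n : ℕ) (A : Finset (Submodule (ZMod 2) (Bits n))) where
  B : Type u
  C : Type u
  [fintypeB : Fintype B]
  [fintypeC : Fintype C]
  [decidableEqB : DecidableEq B]
  [decidableEqC : DecidableEq C]
  split : Op (Bits n) →ₗ[ℂ] Op (B × C)
  bob : A → Bits (n / 2) → Op B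
  charlie : A → Bits (n / 2) → Bits (n / 2) → Op C
  split_isChannel : IsChannel split
  bob_isPOVM : ∀ a, IsPOVM (bob a)
  charlie_isPOVM : ∀ a t, IsPOVM (charlie a t)

attribute [instance] Strategy.fintypeB Strategy.fintypeC
  Strategy.decidableEqB Strategy.decidableEqC

/-- The winning probability
`𝔼_{a ∈ A} 𝔼_{t, t' ∈ ℤ₂^{n/2}} Tr[(B^a_t ⊗ C^{a,t}_{t'}) Φ(|a_{t,t'}⟩⟨a_{t,t'}|)]`.
The trace is that of a product of two positive semidefinite operators, hence real. -/
def winProb {n : ℕ} {A : Finset (Submodule (ZMod 2) (Bits n))}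
    (r : Submodule (ZMod 2) (Bits n) → (Bits (n / 2) →ₗ[ZMod 2] Bits n))
    (S : Strategy.{u} n A) : ℝ :=
  𝔼 a : A, 𝔼 t : Bits (n / 2), 𝔼 t' : Bits (n / 2),
    (((S.bob a t ⊗ₖ S.charlie a t t') *
      S.split (ketbra (labelledCosetState r a t t'))).trace).re

/-- The optimal winning probability: the supremum over all quantum strategies. -/
def optWinProb {n : ℕ} (A : Finset (Submodule (ZMod 2) (Bits n)))
    (r : Submodule (ZMod 2) (Bits n) → (Bits (n / 2) →ₗ[ZMod 2] Bits n)) : ℝ :=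
  ⨆ S : Strategy.{u} n A, winProb r S

end LeakyMoE

end

/-! Write the winning probability at a subspace `a` as `2^{-n} Tr(G_a J)`, where `J` is the Choi
matrix of the splitting channel, positive of trace `2^n`, and `G_a = ∑_{t,t'} |a_{t,t'}⟩⟨a_{t,t'}| ⊗
B^a_t ⊗ C^{a,t}_{t'}` (`winProbAt_eq_trace`). A sum of winning probabilities over a family of
subspaces is then at most the operator norm of `∑ G_a`.

That norm is bounded by a Schur test (`sum_le_smul_one_of_sandwich`), which needs `G_b G_a G_b ≤ c²
G_b` with `c² = |a ∩ b| / 2^{n/2}` (`gameOp_sandwich_le`). To get it, Charlie's part of `G_a` is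
bounded by the identity; what remains on Alice's side is the projection onto a coset of `a`, which
is diagonal. It creates no cross terms between different cosets of `b`, and within one coset
Charlie's measurement, made projective by dilation, removes the cross terms. Charlie's measurement
may thus depend on Bob's guess.

For register subspaces the row sums of `c` are at most `C(m, ⌊m/2⌋) (1 + 1/√2)^m`, where `m = n/2`
and `1 + 1/√2 = 2 cos²(π/8)`. Dividing by the `C(2m, m)` register subspaces costs only the factor
`√e` (`choose_half_mul_two_pow_le`). For all subspaces, every image of the register family under an
invertible linear map has the same intersection sizes, and averaging over these maps gives the same
bound. -/

namespace LeakyMoE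

open scoped Kronecker BigOperators ComplexOrder MatrixOrder
open Matrix

/-! ### Loewner order and the Schur test. -/

section Loewner

variable {X : Type*} [Fintype X]

/-- The quadratic form of `Rᴴ * R` is the squared Euclidean norm of the image under `R`. -/
theorem dotProduct_conjTranspose_mul_self {Y : Type*} [Fintype Y] (R : Matrix Y X ℂ) (x y : X → ℂ) :
    star x ⬝ᵥ ((Rᴴ * R) *ᵥ y) = star (R *ᵥ x) ⬝ᵥ (R *ᵥ y) := by
  rw [← mulVec_mulVec, dotProduct_mulVec, ← star_mulVec]

theorem re_star_dotProduct_le (x y : X → ℂ) :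
    (star x ⬝ᵥ y).re ≤ ‖WithLp.toLp 2 x‖ * ‖WithLp.toLp 2 y‖ := by
  have h := re_inner_le_norm (𝕜 := ℂ) (WithLp.toLp 2 x) (WithLp.toLp 2 y)
  rwa [EuclideanSpace.inner_eq_star_dotProduct, dotProduct_comm] at h

theorem star_dotProduct_self (x : X → ℂ) :
    star x ⬝ᵥ x = ((‖WithLp.toLp 2 x‖ ^ 2 : ℝ) : ℂ) := by
  have h := inner_self_eq_norm_sq_to_K (𝕜 := ℂ) (WithLp.toLp 2 x)
  rw [EuclideanSpace.inner_eq_star_dotProduct, dotProduct_comm] at h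
  simpa using h

theorem le_iff_re_dotProduct {A B : Op X} (hA : A.IsHermitian) (hB : B.IsHermitian) :
    A ≤ B ↔ ∀ x : X → ℂ, (star x ⬝ᵥ (A *ᵥ x)).re ≤ (star x ⬝ᵥ (B *ᵥ x)).re := by
  rw [Matrix.le_iff, posSemidef_iff_dotProduct_mulVec]
  refine ⟨fun h x => ?_, fun h => ⟨hB.sub hA, fun x => ?_⟩⟩
  · have := (Complex.le_def.1 (h.2 x)).1
    simpa [sub_mulVec, dotProduct_sub] using this
  · refine Complex.le_def.2 ⟨?_, ?_⟩
    · simpa [sub_mulVec, dotProduct_sub] using h x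
    · have := (hB.sub hA).im_star_dotProduct_mulVec_self x
      simpa using this.symm

/-- A Schur test for sums of positive operators. -/
theorem sum_le_smul_one_of_sandwich [DecidableEq X] {I : Type*} [Fintype I] {P : I → Op X}
    (hP : ∀ i, (P i).PosSemidef) {c : I → I → ℝ} (hc : ∀ i j, 0 ≤ c i j)
    (hsymm : ∀ i j, c i j = c j i) (h : ∀ i j, P j * P i * P j ≤ (c i j ^ 2) • P j)
    {K : ℝ} (hK : 0 ≤ K) (hrow : ∀ i, ∑ j, c i j ≤ K) :
    ∑ i, P i ≤ K • (1 : Op X) := by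
  -- With `P i = (R i)ᴴ * R i`, the numbers `a i = ‖R i x‖` satisfy `∑ a i ^ 2 = ⟨x, ∑ P i x⟩ = p`,
  -- the quantity to be bounded.
  choose R hR using fun i => CStarAlgebra.nonneg_iff_eq_star_mul_self.mp (hP i).nonneg
  simp only [star_eq_conjTranspose] at hR
  have hsum : (∑ i, P i).PosSemidef := posSemidef_sum _ fun i _ => hP i
  rw [le_iff_re_dotProduct hsum.1 ((PosSemidef.one.smul hK).1)]
  intro x
  set N : (X → ℂ) → ℝ := fun v => ‖WithLp.toLp 2 v‖ with hN
  have hPN : ∀ i v, star v ⬝ᵥ (P i *ᵥ v) = ((N (R i *ᵥ v) ^ 2 : ℝ) : ℂ) := by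
    intro i v
    rw [hR, dotProduct_conjTranspose_mul_self, star_dotProduct_self]
  have hherm : ∀ i v w, star (P i *ᵥ v) ⬝ᵥ w = star v ⬝ᵥ (P i *ᵥ w) := by
    intro i v w
    rw [star_mulVec, ← dotProduct_mulVec, (hP i).1.eq]
  set a : I → ℝ := fun i => N (R i *ᵥ x) with ha
  have ha0 : ∀ i, 0 ≤ a i := fun i => norm_nonneg _
  have hRP : ∀ i j, N (R i *ᵥ (P j *ᵥ x)) ≤ c i j * a j := by
    intro i j
    have h1 := (le_iff_re_dotProduct ?_ ?_).1 (h i j) x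
    · have h2 : star x ⬝ᵥ ((P j * P i * P j) *ᵥ x) = ((N (R i *ᵥ (P j *ᵥ x)) ^ 2 : ℝ) : ℂ) := by
        rw [← hPN, hherm, mulVec_mulVec, mulVec_mulVec, mul_assoc]
      rw [h2, smul_mulVec, dotProduct_smul, hPN] at h1
      simp only [Complex.ofReal_re, Complex.real_smul, ← Complex.ofReal_mul] at h1
      refine le_of_sq_le_sq ?_ (mul_nonneg (hc i j) (ha0 j))
      rw [mul_pow]
      exact h1
    · have := (hP i).mul_mul_conjTranspose_same (P j)
      rw [(hP j).1.eq] at this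
      exact this.1
    · exact ((hP j).smul (sq_nonneg (c i j))).1
  set p : ℝ := ∑ i, a i ^ 2 with hp
  have hp0 : 0 ≤ p := Finset.sum_nonneg fun i _ => sq_nonneg _
  have hpx : star x ⬝ᵥ ((∑ i, P i) *ᵥ x) = (p : ℂ) := by
    rw [sum_mulVec, dotProduct_sum, hp, Complex.ofReal_sum]
    exact Finset.sum_congr rfl fun i _ => hPN i x
  have hT : N ((∑ i, P i) *ᵥ x) ^ 2 ≤ K * p := by
    have h1 : ((N ((∑ i, P i) *ᵥ x) ^ 2 : ℝ) : ℂ) =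
        ∑ i, ∑ j, star x ⬝ᵥ (P i *ᵥ (P j *ᵥ x)) := by
      rw [hN, ← star_dotProduct_self, sum_mulVec, star_sum, sum_dotProduct]
      refine Finset.sum_congr rfl fun i _ => ?_
      rw [dotProduct_sum]
      exact Finset.sum_congr rfl fun j _ => hherm i x _
    have h2 : N ((∑ i, P i) *ᵥ x) ^ 2 = ∑ i, ∑ j, (star x ⬝ᵥ (P i *ᵥ (P j *ᵥ x))).re := by
      simpa only [Complex.ofReal_re, Complex.re_sum] using congrArg Complex.re h1
    -- Cauchy–Schwarz gives `a i * c i j * a j`; splitting it by AM-GM leaves two halves, both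
    -- controlled by row sums because `c` is symmetric.
    have h3 : ∀ i j, (star x ⬝ᵥ (P i *ᵥ (P j *ᵥ x))).re ≤
        c i j * (a i ^ 2) / 2 + c j i * (a j ^ 2) / 2 := by
      intro i j
      have h4 : (star x ⬝ᵥ (P i *ᵥ (P j *ᵥ x))).re ≤ a i * (c i j * a j) := by
        rw [hR i, dotProduct_conjTranspose_mul_self]
        exact (re_star_dotProduct_le _ _).trans
          (mul_le_mul_of_nonneg_left (hRP i j) (norm_nonneg _))
      rw [hsymm j i]
      nlinarith [mul_nonneg (hc i j) (sq_nonneg (a i - a j))]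
    have h5 : ∑ i, ∑ j, c i j * (a i ^ 2) / 2 ≤ K * p / 2 := by
      rw [hp, Finset.mul_sum, Finset.sum_div]
      refine Finset.sum_le_sum fun i _ => ?_
      rw [← Finset.sum_div, ← Finset.sum_mul]
      have := mul_le_mul_of_nonneg_right (hrow i) (sq_nonneg (a i))
      linarith
    rw [h2]
    calc _ ≤ ∑ i, ∑ j, (c i j * (a i ^ 2) / 2 + c j i * (a j ^ 2) / 2) :=
          Finset.sum_le_sum fun i _ => Finset.sum_le_sum fun j _ => h3 i j
      _ = ∑ i, ∑ j, c i j * (a i ^ 2) / 2 + ∑ i, ∑ j, c i j * (a i ^ 2) / 2 := by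
          simp only [Finset.sum_add_distrib]
          congr 1
          exact Finset.sum_comm
      _ ≤ K * p := by linarith
  have hCS : p ≤ N x * N ((∑ i, P i) *ᵥ x) := by
    have := re_star_dotProduct_le x ((∑ i, P i) *ᵥ x)
    rwa [hpx, Complex.ofReal_re] at this
  rw [hpx, smul_mulVec, one_mulVec, dotProduct_smul, star_dotProduct_self, Complex.ofReal_re,
    Complex.real_smul, ← Complex.ofReal_mul, Complex.ofReal_re]
  change p ≤ K * N x ^ 2
  rcases hp0.eq_or_lt with h0 | h0
  · rw [← h0]; positivity
  -- Both `p ≤ ‖x‖ ‖∑ P i x‖` and `‖∑ P i x‖² ≤ K p` are available; one factor `p` cancels.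
  · have h1 : p * p ≤ p * (K * N x ^ 2) := by
      calc p * p ≤ (N x * N ((∑ i, P i) *ᵥ x)) * (N x * N ((∑ i, P i) *ᵥ x)) :=
            mul_self_le_mul_self hp0 hCS
        _ = N x ^ 2 * N ((∑ i, P i) *ᵥ x) ^ 2 := by ring
        _ ≤ N x ^ 2 * (K * p) := mul_le_mul_of_nonneg_left hT (sq_nonneg _)
        _ = _ := by ring
    exact le_of_mul_le_mul_left h1 h0

end Loewner

/-- A POVM dilates to a family of mutually orthogonal projections. -/
theorem IsPOVM.exists_dilation {S X : Type*} [Fintype S] [DecidableEq S] [Fintype X] [DecidableEq X]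
    {P : S → Op X} (hP : IsPOVM P) :
    ∃ Q : S → Op (X ⊕ (S × X)), (∀ s, (Q s).IsHermitian) ∧
      (∀ s t, Q s * Q t = if s = t then Q s else 0) ∧
      ∀ s, (Q s).submatrix Sum.inl Sum.inl = P s := by
  choose R hR using fun s =>
    CStarAlgebra.nonneg_iff_eq_star_mul_self.mp (hP.posSemidef s).nonneg
  simp only [star_eq_conjTranspose] at hR
  -- Naimark isometry: the factors `R s` of `P s` stacked, with `E s` the projection onto block `s`.
  let V : Matrix (S × X) X ℂ := Matrix.of fun p y => R p.1 p.2 y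
  let E : S → Op (S × X) := fun s => diagonal fun p => if p.1 = s then 1 else 0
  have hVE : ∀ s, Vᴴ * E s * V = P s := by
    intro s
    ext i j
    simp [V, E, hR, mul_apply, diagonal_apply, Fintype.sum_prod_type]
  have hE : ∑ s, E s = 1 := by
    ext i j
    rcases eq_or_ne i j with rfl | hij
    · simp [E, Matrix.sum_apply]
    · simp [E, Matrix.sum_apply, hij]
  have hV : Vᴴ * V = 1 := by
    have : Vᴴ * (∑ s, E s) * V = 1 := by
      rw [Matrix.mul_sum, Matrix.sum_mul, ← hP.sum_eq_one]
      exact Finset.sum_congr rfl fun s _ => hVE s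
    rwa [hE, Matrix.mul_one] at this
  have hEE : ∀ s t, E s * E t = if s = t then E s else 0 := by
    intro s t
    simp only [E, diagonal_mul_diagonal]
    split_ifs with h
    · subst h
      congr 1
      ext p
      split_ifs <;> simp
    · rw [← diagonal_zero]
      congr 1
      ext p
      split_ifs with h1 h2 <;> simp
      exact h (h1.symm.trans h2)
  -- A coisometry extending `V`: `K Kᴴ = V Vᴴ + (1 - V Vᴴ)² = 1`. Conjugating `E s` by it keeps the
  -- products, and the corner is `Vᴴ E s V`. The projections need not sum to the identity.
  let K : Matrix (S × X) (X ⊕ (S × X)) ℂ := fromCols V (1 - V * Vᴴ)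
  have hK : K * Kᴴ = 1 := by
    simp only [K, conjTranspose_fromCols_eq_fromRows_conjTranspose, fromCols_mul_fromRows]
    rw [conjTranspose_sub, conjTranspose_one, conjTranspose_mul, conjTranspose_conjTranspose,
      Matrix.mul_sub, Matrix.sub_mul, Matrix.sub_mul, Matrix.mul_one, Matrix.mul_one,
      Matrix.one_mul, Matrix.mul_assoc V, ← Matrix.mul_assoc Vᴴ, hV, Matrix.one_mul]
    abel
  refine ⟨fun s => Kᴴ * E s * K, fun s => ?_, fun s t => ?_, fun s => ?_⟩
  · refine isHermitian_conjTranspose_mul_mul _ ?_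
    refine isHermitian_diagonal_of_self_adjoint _ ?_
    ext p
    simp only [Pi.star_apply]
    split_ifs <;> simp
  · have : Kᴴ * E s * K * (Kᴴ * E t * K) = Kᴴ * (E s * (K * Kᴴ) * E t) * K := by
      simp only [Matrix.mul_assoc]
    rw [this, hK, Matrix.mul_one, hEE]
    split_ifs <;> simp
  · rw [← hVE s]
    ext i j
    simp [K, mul_apply]

theorem ketbra_posSemidef {X : Type*} [Fintype X] (ψ : X → ℂ) : (ketbra ψ).PosSemidef :=
  posSemidef_vecMulVec_self_star ψ

/-! ### Game operators and their sandwich inequality. -/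

/-- The operator whose expectation is the winning probability for a fixed challenge basis `ψ`. -/
def gameOp {S T V B C : Type*} [Fintype S] [Fintype T] (ψ : S → T → V → ℂ)
    (β : S → Op B) (γ : S → T → Op C) : Op (V × (B × C)) :=
  ∑ s, ∑ t, ketbra (ψ s t) ⊗ₖ (β s ⊗ₖ γ s t)

theorem sum_mul_sum_mul_sum_of_orthogonal {R I S : Type*} [NonUnitalSemiring R] [Fintype I]
    [DecidableEq I] [Fintype S] {a : I → R} {m : S → R} {b : I → S → R}
    (h : ∀ i j s, a i * m s * a j = if i = j then b i s else 0) :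
    (∑ i, a i) * (∑ s, m s) * ∑ i, a i = ∑ i, ∑ s, b i s := by
  rw [Finset.sum_mul_sum, Finset.sum_mul]
  refine Finset.sum_congr rfl fun i _ => ?_
  rw [Finset.sum_mul]
  refine Finset.sum_congr rfl fun s _ => ?_
  rw [Finset.mul_sum]
  simp [h]

section Sandwich

variable {S T V B C : Type*} [Fintype S] [Fintype T] [Fintype V] [Fintype B] [Fintype C]

theorem gameOp_posSemidef {ψ : S → T → V → ℂ} {β : S → Op B} {γ : S → T → Op C}
    (hβ : ∀ s, (β s).PosSemidef) (hγ : ∀ s t, (γ s t).PosSemidef) :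
    (gameOp ψ β γ).PosSemidef :=
  posSemidef_sum _ fun s _ => posSemidef_sum _ fun t _ =>
    (ketbra_posSemidef _).kronecker ((hβ s).kronecker (hγ s t))

/-- Forgetting Charlie's answer can only increase the game operator. -/
theorem gameOp_le_of_forall_le_one [DecidableEq C] {ψ : S → T → V → ℂ} {β : S → Op B} {γ : S → T → Op C}
    (hβ : ∀ s, (β s).PosSemidef) (hγ : ∀ s t, γ s t ≤ 1) {D : S → Op V}
    (hD : ∀ s, ∑ t, ketbra (ψ s t) = D s) :
    gameOp ψ β γ ≤ ∑ s, D s ⊗ₖ (β s ⊗ₖ (1 : Op C)) := by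
  refine Finset.sum_le_sum fun s _ => ?_
  have hexp : D s ⊗ₖ (β s ⊗ₖ (1 : Op C)) = ∑ t, ketbra (ψ s t) ⊗ₖ (β s ⊗ₖ (1 : Op C)) := by
    rw [← hD]
    ext i j
    simp [Matrix.sum_apply, Finset.sum_mul]
  rw [hexp]
  refine Finset.sum_le_sum fun t _ => ?_
  rw [Matrix.le_iff]
  have : ketbra (ψ s t) ⊗ₖ (β s ⊗ₖ (1 : Op C)) - ketbra (ψ s t) ⊗ₖ (β s ⊗ₖ γ s t) =
      ketbra (ψ s t) ⊗ₖ (β s ⊗ₖ (1 - γ s t)) := by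
    ext i j
    simp [mul_sub]
  rw [this]
  exact (ketbra_posSemidef _).kronecker ((hβ s).kronecker (Matrix.le_iff.1 (hγ s t)))

theorem ketbra_mul_mul_ketbra (φ χ : V → ℂ) (D : Op V) :
    ketbra φ * D * ketbra χ = (star φ ⬝ᵥ (D *ᵥ χ)) • vecMulVec φ (star χ) := by
  rw [ketbra, ketbra, mul_assoc, mul_vecMulVec, vecMulVec_mul_vecMulVec, vecMulVec_smul]

theorem IsPOVM.le_one {B : Type*} [DecidableEq B] {P : S → Op B} (hP : IsPOVM P) (s : S) : P s ≤ 1 := by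
  rw [← hP.sum_eq_one]
  exact Finset.single_le_sum (fun i _ => (hP.posSemidef i).nonneg) (Finset.mem_univ s)

/-- The difference is `M (1 - M) M + (1 - M) M (1 - M)`, a sum of positive operators. -/
theorem mul_self_le_of_le_one [DecidableEq B] {M : Op B} (h0 : M.PosSemidef) (h1 : M ≤ 1) : M * M ≤ M := by
  rw [Matrix.le_iff] at h1 ⊢
  have h2 := (h1.mul_mul_conjTranspose_same M).add (h0.mul_mul_conjTranspose_same (1 - M))
  rw [h0.1.eq, h1.1.eq] at h2
  convert h2 using 1
  noncomm_ring

/-- If Bob measures `β` for one challenge and `β'` for the other, and all overlaps of the second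
challenge basis with the first one are at most `c`, then the game operators satisfy
`G' G G' ≤ c G'`, provided that Charlie's measurements for the second challenge are projective. -/
theorem gameOp_sandwich_le [DecidableEq S] [DecidableEq T] [DecidableEq B] [DecidableEq C]
    {ψ ψ' : S → T → V → ℂ} {β β' : S → Op B} {γ γ' : S → T → Op C}
    (hβ : IsPOVM β) (hβ' : IsPOVM β') (hγ : ∀ s t, γ s t ≤ 1)
    (hγ'h : ∀ s t, (γ' s t).IsHermitian)
    (hγ' : ∀ s t u, γ' s t * γ' s u = if t = u then γ' s t else 0)
    {D : S → Op V} (hD : ∀ s, ∑ t, ketbra (ψ s t) = D s) {c : ℝ} (hc : 0 ≤ c)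
    (hoff : ∀ s t t' u u', t ≠ u → star (ψ' t t') ⬝ᵥ (D s *ᵥ ψ' u u') = 0)
    (hdiag : ∀ s t t', star (ψ' t t') ⬝ᵥ (D s *ᵥ ψ' t t') ≤ (c : ℂ)) :
    gameOp ψ' β' γ' * gameOp ψ β γ * gameOp ψ' β' γ' ≤ c • gameOp ψ' β' γ' := by
  have hγ'p : ∀ s t, (γ' s t).PosSemidef := by
    intro s t
    have := posSemidef_conjTranspose_mul_self (γ' s t)
    rwa [(hγ'h s t).eq, hγ', if_pos rfl] at this
  have hG' := gameOp_posSemidef (ψ := ψ') hβ'.posSemidef hγ'p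
  set G' := gameOp ψ' β' γ' with hG'_def
  set Q : Op (V × (B × C)) := ∑ s, D s ⊗ₖ (β s ⊗ₖ (1 : Op C)) with hQ
  have h1 : G' * gameOp ψ β γ * G' ≤ G' * Q * G' := by
    rw [Matrix.le_iff]
    have h := (Matrix.le_iff.1
      (gameOp_le_of_forall_le_one hβ.posSemidef hγ hD)).mul_mul_conjTranspose_same G'
    rw [hG'.1.eq] at h
    convert h using 1
    noncomm_ring
  refine h1.trans ?_
  have h2 : G' * Q * G' = ∑ t, ∑ t', ketbra (ψ' t t') ⊗ₖ
      ((∑ s, (star (ψ' t t') ⬝ᵥ (D s *ᵥ ψ' t t')) • (β' t * β s * β' t)) ⊗ₖ γ' t t') := by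
    have key : ∀ t t' s u u', ketbra (ψ' t t') ⊗ₖ (β' t ⊗ₖ γ' t t') * D s ⊗ₖ (β s ⊗ₖ (1 : Op C)) *
        ketbra (ψ' u u') ⊗ₖ (β' u ⊗ₖ γ' u u') = if t = u ∧ t' = u' then
          ketbra (ψ' t t') ⊗ₖ
            (((star (ψ' t t') ⬝ᵥ (D s *ᵥ ψ' t t')) • (β' t * β s * β' t)) ⊗ₖ γ' t t') else 0 := by
      intro t t' s u u'
      simp only [← mul_kronecker_mul, Matrix.mul_one, ketbra_mul_mul_ketbra]
      -- Different Bob outcomes are killed by `hoff`, different Charlie outcomes by orthogonality of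
      -- the projections `γ' t`.
      by_cases htu : t = u
      · subst htu
        rw [hγ']
        by_cases htu' : t' = u'
        · subst htu'
          simp [ketbra, kronecker_smul, smul_kronecker]
        · simp [htu']
      · simp [htu, hoff s t t' u u' htu]
    have hprod : G' = ∑ p : S × T, ketbra (ψ' p.1 p.2) ⊗ₖ (β' p.1 ⊗ₖ γ' p.1 p.2) := by
      rw [Fintype.sum_prod_type, hG'_def, gameOp]
    have key' := fun (p q : S × T) s =>
      (key p.1 p.2 s q.1 q.2).trans (if_congr Prod.ext_iff.symm rfl rfl)
    rw [hprod, hQ, sum_mul_sum_mul_sum_of_orthogonal key', Fintype.sum_prod_type]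
    refine Finset.sum_congr rfl fun t _ => Finset.sum_congr rfl fun t' _ => ?_
    have hsum : ketbra (ψ' t t') ⊗ₖ ((∑ s, (star (ψ' t t') ⬝ᵥ (D s *ᵥ ψ' t t')) •
        (β' t * β s * β' t)) ⊗ₖ γ' t t') = ∑ s, ketbra (ψ' t t') ⊗ₖ
          (((star (ψ' t t') ⬝ᵥ (D s *ᵥ ψ' t t')) • (β' t * β s * β' t)) ⊗ₖ γ' t t') := by
      ext i j
      simp [Matrix.sum_apply, Finset.sum_mul, Finset.mul_sum]
    rw [hsum]
  rw [h2, hG'_def, gameOp, Finset.smul_sum]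
  refine Finset.sum_le_sum fun t _ => ?_
  rw [Finset.smul_sum]
  refine Finset.sum_le_sum fun t' _ => ?_
  -- Once each weight is replaced by `c`, the sum over `s` of `β s` is the identity and `β' t * β' t
  -- ≤ β' t` remains, so Bob's measurements need not be projective.
  have h3 : ∑ s, (star (ψ' t t') ⬝ᵥ (D s *ᵥ ψ' t t')) • (β' t * β s * β' t) ≤ (c : ℂ) • β' t := by
    have h5 : ∑ s, (c : ℂ) • (β' t * β s * β' t) = (c : ℂ) • (β' t * β' t) := by
      rw [← Finset.smul_sum, ← Matrix.sum_mul, ← Matrix.mul_sum, hβ.sum_eq_one, Matrix.mul_one]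
    calc _ ≤ ∑ s, (c : ℂ) • (β' t * β s * β' t) := by
          refine Finset.sum_le_sum fun s _ => ?_
          rw [Matrix.le_iff, ← sub_smul]
          refine PosSemidef.smul ?_ (sub_nonneg.2 (hdiag s t t'))
          have := (hβ.posSemidef s).mul_mul_conjTranspose_same (β' t)
          rwa [(hβ'.posSemidef t).1.eq] at this
      _ ≤ _ := by
          rw [h5, Matrix.le_iff, ← smul_sub]
          exact (Matrix.le_iff.1 (mul_self_le_of_le_one (hβ'.posSemidef t) (hβ'.le_one t))).smul
            (by exact_mod_cast hc)
  have h4 : c • ketbra (ψ' t t') ⊗ₖ (β' t ⊗ₖ γ' t t') =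
      ketbra (ψ' t t') ⊗ₖ (((c : ℂ) • β' t) ⊗ₖ γ' t t') := by
    ext i j
    simp [kroneckerMap_apply]
    ring
  rw [h4, Matrix.le_iff]
  have h6 := (ketbra_posSemidef (ψ' t t')).kronecker
    ((Matrix.le_iff.1 h3).kronecker (hγ'p t t'))
  convert h6 using 1
  ext i j
  simp only [Matrix.sub_apply, kroneckerMap_apply]
  ring

end Sandwich

section Family

variable {I S T V B C : Type*} [Fintype I] [Fintype S] [DecidableEq S] [Fintype T] [DecidableEq T]
  [Fintype V] [DecidableEq V] [Fintype B] [DecidableEq B] [Fintype C] [DecidableEq C]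

/-- A family of game operators whose challenge bases have pairwise overlaps at most `c i j ^ 2` is
bounded in sum by the row sums of `c`. -/
theorem sum_gameOp_le {ψ : I → S → T → V → ℂ} {β : I → S → Op B} {γ : I → S → T → Op C}
    (hβ : ∀ i, IsPOVM (β i)) (hγ : ∀ i s, IsPOVM (γ i s)) {D : I → S → Op V}
    (hD : ∀ i s, ∑ t, ketbra (ψ i s t) = D i s) {c : I → I → ℝ} (hc : ∀ i j, 0 ≤ c i j)
    (hsymm : ∀ i j, c i j = c j i)
    (hoff : ∀ i j s t t' u u', t ≠ u → star (ψ j t t') ⬝ᵥ (D i s *ᵥ ψ j u u') = 0)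
    (hdiag : ∀ i j s t t', star (ψ j t t') ⬝ᵥ (D i s *ᵥ ψ j t t') ≤ ((c i j ^ 2 : ℝ) : ℂ))
    {K : ℝ} (hK : 0 ≤ K) (hrow : ∀ i, ∑ j, c i j ≤ K) :
    ∑ i, gameOp (ψ i) (β i) (γ i) ≤ K • (1 : Op (V × (B × C))) := by
  choose Q hQh hQ hQs using fun i s => (hγ i s).exists_dilation
  have hQp : ∀ i s t, (Q i s t).PosSemidef := by
    intro i s t
    have := posSemidef_conjTranspose_mul_self (Q i s t)
    rwa [(hQh i s t).eq, hQ, if_pos rfl] at this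
  have hQ1 : ∀ i s t, Q i s t ≤ 1 := by
    intro i s t
    have := posSemidef_conjTranspose_mul_self (1 - Q i s t)
    rw [conjTranspose_sub, conjTranspose_one, (hQh i s t).eq] at this
    rw [Matrix.le_iff]
    simpa [Matrix.mul_sub, Matrix.sub_mul, hQ] using this
  have hdil := sum_le_smul_one_of_sandwich (P := fun i => gameOp (ψ i) (β i) (Q i))
    (fun i => gameOp_posSemidef (hβ i).posSemidef (hQp i)) hc hsymm
    (fun i j => gameOp_sandwich_le (hβ i) (hβ j) (hQ1 i) (hQh j) (hQ j) (hD i) (sq_nonneg _)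
      (hoff i j) (hdiag i j)) hK hrow
  rw [Matrix.le_iff] at hdil ⊢
  -- Compression to the original space of Charlie turns the dilated projections back into his POVM
  -- and preserves the order.
  have := hdil.submatrix
    (fun p : V × (B × C) => ((p.1, (p.2.1, Sum.inl p.2.2)) : V × (B × (C ⊕ (T × C)))))
  convert this using 1
  ext p q
  have h1 : ∀ i s t, γ i s t p.2.2 q.2.2 = Q i s t (Sum.inl p.2.2) (Sum.inl q.2.2) :=
    fun i s t => by rw [← hQs i s]; rfl
  simp [gameOp, Matrix.sum_apply, h1, one_apply, Prod.ext_iff]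

end Family

/-! ### Choi matrices. -/

section Choi

theorem re_trace_mul_nonneg {X : Type*} [Fintype X] {M J : Op X} (hM : M.PosSemidef)
    (hJ : J.PosSemidef) : 0 ≤ (M * J).trace.re := by
  classical
  obtain ⟨R, rfl⟩ := CStarAlgebra.nonneg_iff_eq_star_mul_self.mp hJ.nonneg
  rw [star_eq_conjTranspose, ← Matrix.mul_assoc, trace_mul_comm, ← Matrix.mul_assoc]
  exact (Complex.le_def.1 (hM.mul_mul_conjTranspose_same R).trace_nonneg).1

variable {V Y : Type*} [Fintype V] [DecidableEq V] [Fintype Y]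

/-- The Choi matrix of a linear map between matrix algebras. -/
def choi (Φ : Op V →ₗ[ℂ] Op Y) : Op (V × Y) :=
  ampliate V Φ (vecMulVec (fun p : V × V => if p.1 = p.2 then 1 else 0)
    (star fun p : V × V => if p.1 = p.2 then 1 else 0))

omit [Fintype V] [Fintype Y] in
theorem choi_apply (Φ : Op V →ₗ[ℂ] Op Y) (p q : V × Y) :
    choi Φ p q = Φ (Matrix.single p.1 q.1 1) p.2 q.2 := by
  unfold choi ampliate
  rw [of_apply]
  refine congrArg (fun M => Φ M p.2 q.2) ?_
  ext x x'
  simp only [of_apply, vecMulVec_apply, Pi.star_apply, single_apply]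
  by_cases h1 : p.1 = x <;> by_cases h2 : q.1 = x' <;> simp [h1, h2]

theorem IsChannel.choi_posSemidef {V : Type} [Fintype V] [DecidableEq V]
    {Φ : Op V →ₗ[ℂ] Op Y} (hΦ : IsChannel Φ) : (choi Φ).PosSemidef :=
  hΦ.completelyPositive V _ (posSemidef_vecMulVec_self_star _)

/-- The maximally entangled vector in `choi` is not normalised, hence the dimension instead of `1`.
-/
theorem IsChannel.trace_choi {Φ : Op V →ₗ[ℂ] Op Y} (hΦ : IsChannel Φ) :
    (choi Φ).trace = Fintype.card V := by
  have h : ∀ v, ∑ y, choi Φ (v, y) (v, y) = 1 := by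
    intro v
    simp only [choi_apply]
    have := hΦ.tracePreserving (Matrix.single v v 1)
    rwa [trace_single_eq_same] at this
  simp [Matrix.trace, Fintype.sum_prod_type, h]

/-- The usual Choi formula has the transpose of the input state; for a real vector it is the state
itself. -/
theorem trace_mul_apply_ketbra (Φ : Op V →ₗ[ℂ] Op Y) (N : Op Y) {ψ : V → ℂ} (hψ : star ψ = ψ) :
    (N * Φ (ketbra ψ)).trace = ((ketbra ψ ⊗ₖ N) * choi Φ).trace := by
  have h : Φ (ketbra ψ) = ∑ v, ∑ w, (ψ v * ψ w) • Φ (Matrix.single v w 1) := by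
    conv_lhs => rw [matrix_eq_sum_single (ketbra ψ)]
    simp only [map_sum, ← map_smul, smul_single, ketbra, vecMulVec_apply, hψ]
    simp
  rw [h]
  simp only [Matrix.trace, diag_apply, mul_apply, Fintype.sum_prod_type, choi_apply,
    kroneckerMap_apply, Matrix.sum_apply, Matrix.smul_apply, ketbra, vecMulVec_apply, hψ,
    Finset.mul_sum, smul_eq_mul]
  simp only [← Finset.sum_product', Finset.univ_product_univ]
  refine Fintype.sum_equiv ⟨fun p => ⟨p.2.2.1, p.1, p.2.1, p.2.2.2⟩,
    fun q => ⟨q.2.1, q.2.2.1, q.1, q.2.2.2⟩, fun _ => rfl, fun _ => rfl⟩ _ _ fun p => ?_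
  simp only [Equiv.coe_fn_mk]
  ring

end Choi

/-! ### Coset states and their overlaps. -/

section CosetStates

variable {n : ℕ}

theorem neg_one_pow_val_add (x y : ZMod 2) :
    (-1 : ℂ) ^ (x + y).val = (-1) ^ x.val * (-1) ^ y.val := by
  rw [ZMod.val_add, ← pow_add, neg_one_pow_eq_pow_mod_two, Nat.mod_mod, ← neg_one_pow_eq_pow_mod_two]

theorem bits_sub_eq_add (v w : Bits n) : v - w = v + w := by
  ext i
  exact CharTwo.sub_eq_add _ _

theorem add_eq_iff_eq_add (u v t : Bits n) : u + t = v ↔ u = v + t :=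
  (bits_sub_eq_add v t) ▸ eq_sub_iff_add_eq.symm

open Classical in
theorem cosetState_apply (a : Submodule (ZMod 2) (Bits n)) (t t' v : Bits n) :
    cosetState a t t' v = if v + t ∈ a then
      ((1 / Real.sqrt (Nat.card a) : ℝ) : ℂ) * (-1) ^ ((v + t) ⬝ᵥ t').val else 0 := by
  have h : (∑ u ∈ Finset.univ.filter (fun u : Bits n => u ∈ a),
      ((-1 : ℂ) ^ (u ⬝ᵥ t').val) • (Pi.single (u + t) 1 : Bits n → ℂ)) v =
      if v + t ∈ a then (-1) ^ ((v + t) ⬝ᵥ t').val else 0 := by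
    rw [Finset.sum_apply, Finset.sum_filter]
    simp only [Pi.smul_apply, Pi.single_apply, smul_eq_mul, mul_ite, mul_one, mul_zero]
    rw [Finset.sum_eq_single (v + t)]
    · rw [if_pos ((add_eq_iff_eq_add _ _ _).2 rfl).symm]
    · intro u _ hu
      have hne : v ≠ u + t := fun h => hu ((add_eq_iff_eq_add _ _ _).1 h.symm)
      simp only [hne, if_false, ite_self]
    · simp
  rw [cosetState, Pi.smul_apply, h, smul_eq_mul, mul_ite, mul_zero]

theorem star_cosetState (a : Submodule (ZMod 2) (Bits n)) (t t' : Bits n) :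
    star (cosetState a t t') = cosetState a t t' := by
  classical
  ext v
  rw [Pi.star_apply, cosetState_apply]
  split_ifs <;> simp

theorem finrank_perp (a : Submodule (ZMod 2) (Bits n)) :
    Module.finrank (ZMod 2) (perp a) = n - Module.finrank (ZMod 2) a := by
  have hB : (Matrix.toBilin' (1 : Matrix (Fin n) (Fin n) (ZMod 2))).Nondegenerate :=
    LinearMap.BilinForm.nondegenerate_toBilin'_of_det_ne_zero' _ (by simp)
  have h : perp a = (Matrix.toBilin' (1 : Matrix (Fin n) (Fin n) (ZMod 2))).orthogonal a := by
    ext v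
    refine forall₂_congr fun u _ => ?_
    rw [Matrix.toBilin'_apply', one_mulVec]
  rw [h, LinearMap.BilinForm.finrank_orthogonal hB, Module.finrank_fin_fun]

/-- A vector of `a` orthogonal to a complement of `perp a` vanishes. -/
theorem eq_zero_of_forall_dotProduct_eq_zero {S : Type*} {a : Submodule (ZMod 2) (Bits n)}
    {f : S → Bits n} (hf : Function.Surjective fun s => (perp a).mkQ (f s)) {x : Bits n}
    (hx : x ∈ a) (h : ∀ s, x ⬝ᵥ f s = 0) : x = 0 := by
  have h1 : ∀ v, x ⬝ᵥ v = 0 := by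
    intro v
    obtain ⟨s, hs⟩ := hf ((perp a).mkQ v)
    have h2 : f s - v ∈ perp a := by
      rw [← Submodule.ker_mkQ (perp a), LinearMap.mem_ker, map_sub, sub_eq_zero]
      exact hs
    have h3 := h2 x hx
    rw [dotProduct_sub, h s, zero_sub, neg_eq_zero] at h3
    exact h3
  exact dotProduct_eq_zero x h1

theorem sum_neg_one_pow_dotProduct {k : ℕ} {a : Submodule (ZMod 2) (Bits n)}
    {f : Bits k →ₗ[ZMod 2] Bits n} (hf : Function.Surjective ((perp a).mkQ ∘ₗ f)) {x : Bits n}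
    (hx : x ∈ a) : ∑ s, (-1 : ℂ) ^ (x ⬝ᵥ f s).val = if x = 0 then 2 ^ k else 0 := by
  split_ifs with h0
  · simp [h0]
  · obtain ⟨s₀, hs₀⟩ : ∃ s, x ⬝ᵥ f s ≠ 0 := by
      by_contra! h
      exact h0 (eq_zero_of_forall_dotProduct_eq_zero hf hx h)
    have h1 : x ⬝ᵥ f s₀ = 1 := by
      revert hs₀
      generalize x ⬝ᵥ f s₀ = z
      revert z
      decide
    -- Translation by `s₀` flips every sign of this nontrivial character sum.
    have h2 : ∑ s, (-1 : ℂ) ^ (x ⬝ᵥ f s).val = -∑ s, (-1 : ℂ) ^ (x ⬝ᵥ f s).val := by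
      conv_lhs => rw [← Equiv.sum_comp (Equiv.addRight s₀)]
      rw [← Finset.sum_neg_distrib]
      refine Finset.sum_congr rfl fun s _ => ?_
      rw [Equiv.coe_addRight, map_add, dotProduct_add, neg_one_pow_val_add, h1]
      simp [ZMod.val_one]
    exact self_eq_neg.1 h2

theorem natCard_submodule (a : Submodule (ZMod 2) (Bits n)) :
    Nat.card a = 2 ^ Module.finrank (ZMod 2) a := by
  rw [Module.natCard_eq_pow_finrank (K := ZMod 2), Nat.card_zmod]

open Classical in
/-- The projections onto the coset states with a fixed shift sum to the projection onto the coset. -/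
theorem sum_ketbra_cosetState {k : ℕ} {a : Submodule (ZMod 2) (Bits n)}
    (ha : Module.finrank (ZMod 2) a = k) {f : Bits k →ₗ[ZMod 2] Bits n}
    (hf : Function.Surjective ((perp a).mkQ ∘ₗ f)) (t : Bits n) :
    ∑ s, ketbra (cosetState a t (f s)) = diagonal fun v => if v + t ∈ a then (1 : ℂ) else 0 := by
  ext v w
  simp only [Matrix.sum_apply, ketbra, vecMulVec_apply, star_cosetState, cosetState_apply,
    diagonal_apply]
  by_cases hv : v + t ∈ a <;> by_cases hw : w + t ∈ a
  · have hvw : v + w ∈ a := by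
      have := a.add_mem hv hw
      rwa [add_add_add_comm, ← bits_sub_eq_add t t, sub_self, add_zero] at this
    have h1 : ∀ s, ((1 / Real.sqrt (Nat.card a) : ℝ) : ℂ) * (-1) ^ ((v + t) ⬝ᵥ f s).val *
        (((1 / Real.sqrt (Nat.card a) : ℝ) : ℂ) * (-1) ^ ((w + t) ⬝ᵥ f s).val) =
        ((2 : ℂ) ^ k)⁻¹ * (-1) ^ ((v + w) ⬝ᵥ f s).val := by
      intro s
      have h2 : ((1 / Real.sqrt (Nat.card a) : ℝ) : ℂ) * ((1 / Real.sqrt (Nat.card a) : ℝ) : ℂ) =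
          ((2 : ℂ) ^ k)⁻¹ := by
        rw [← Complex.ofReal_mul, one_div, ← mul_inv, Real.mul_self_sqrt (Nat.cast_nonneg _),
          natCard_submodule, ha]
        push_cast
        rfl
      have h3 : v + w = (v + t) + (w + t) := by
        rw [add_add_add_comm, ← bits_sub_eq_add t t, sub_self, add_zero]
      rw [mul_mul_mul_comm, h2, ← neg_one_pow_val_add, ← add_dotProduct, ← h3]
    simp only [hv, hw, if_true, h1]
    have h4 : v + w = 0 ↔ v = w := by rw [← bits_sub_eq_add, sub_eq_zero]
    rw [← Finset.mul_sum, sum_neg_one_pow_dotProduct hf hvw]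
    simp only [h4]
    split_ifs <;> simp
  · have hne : v ≠ w := fun h => hw (h ▸ hv)
    simp [hw, hne]
  · simp [hv]
  · simp [hv]

open Classical in
/-- Coset states with shifts in different cosets have disjoint supports. -/
theorem cosetState_dotProduct_diagonal_eq_zero (b : Submodule (ZMod 2) (Bits n))
    {t u : Bits n} (htu : t - u ∉ b) (t' u' : Bits n) (d : Bits n → ℂ) :
    star (cosetState b t t') ⬝ᵥ (diagonal d *ᵥ cosetState b u u') = 0 := by
  refine Finset.sum_eq_zero fun v _ => ?_
  rw [star_cosetState, mulVec_diagonal, cosetState_apply, cosetState_apply]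
  by_cases h1 : v + t ∈ b
  · have h2 : v + u ∉ b := fun h2 => htu (by simpa using b.sub_mem h1 h2)
    simp [h2]
  · simp [h1]

-- The state has weight `1 / |b|` at each point of its coset of `b`, and a coset of `a` meets that
-- coset in nothing or in a coset of `a ⊓ b`.
open Classical in
theorem cosetState_dotProduct_diagonal_le (a b : Submodule (ZMod 2) (Bits n)) (s t t' : Bits n) :
    star (cosetState b t t') ⬝ᵥ
      (diagonal (fun v => if v + s ∈ a then (1 : ℂ) else 0) *ᵥ cosetState b t t') ≤
      (((Nat.card (a ⊓ b : Submodule (ZMod 2) (Bits n)) : ℝ) / Nat.card b : ℝ) : ℂ) := by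
  have h1 : ∀ v, star (cosetState b t t') v *
      ((diagonal (fun v => if v + s ∈ a then (1 : ℂ) else 0) *ᵥ cosetState b t t') v) =
      (((Nat.card b : ℝ)⁻¹ * if v + s ∈ a ∧ v + t ∈ b then 1 else 0 : ℝ) : ℂ) := by
    intro v
    rw [star_cosetState, mulVec_diagonal, cosetState_apply]
    by_cases h1 : v + t ∈ b <;> by_cases h2 : v + s ∈ a <;> simp only [h1, h2] <;> simp
    rw [mul_mul_mul_comm, ← mul_inv, ← Complex.ofReal_mul, Real.mul_self_sqrt (Nat.cast_nonneg _),
      ← pow_add, Even.neg_one_pow ⟨_, rfl⟩]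
    simp
  rw [dotProduct, Finset.sum_congr rfl fun v _ => h1 v, ← Complex.ofReal_sum, ← Finset.mul_sum]
  norm_cast
  rw [div_eq_inv_mul]
  refine mul_le_mul_of_nonneg_left ?_ (by positivity)
  rw [Finset.sum_boole]
  norm_cast
  rcases (Finset.univ.filter fun v : Bits n => v + s ∈ a ∧ v + t ∈ b).eq_empty_or_nonempty with
    h | ⟨v₀, hv₀⟩
  · simp [h]
  · rw [Nat.card_eq_fintype_card, ← Fintype.card_coe]
    rw [Finset.mem_filter] at hv₀
    refine Fintype.card_le_of_injective (fun v => ⟨v.1 - v₀, ?_⟩) ?_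
    · have hv := (Finset.mem_filter.1 v.2).2
      exact ⟨by simpa using a.sub_mem hv.1 hv₀.2.1, by simpa using b.sub_mem hv.2 hv₀.2.2⟩
    · intro v w h
      exact Subtype.ext (sub_left_injective (Subtype.mk.inj h))

end CosetStates

/-! ### Winning probabilities summed over a family of subspaces. -/

section FamilyBound

variable {n : ℕ} {A : Finset (Submodule (ZMod 2) (Bits n))}

/-- The winning probability conditioned on the subspace `a`. -/
noncomputable def winProbAt (r : Submodule (ZMod 2) (Bits n) → (Bits (n / 2) →ₗ[ZMod 2] Bits n))
    (S : Strategy.{u} n A) (a : A) : ℝ :=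
  𝔼 t : Bits (n / 2), 𝔼 t' : Bits (n / 2),
    (((S.bob a t ⊗ₖ S.charlie a t t') *
      S.split (ketbra (labelledCosetState r a t t'))).trace).re

variable {r : Submodule (ZMod 2) (Bits n) → (Bits (n / 2) →ₗ[ZMod 2] Bits n)}

theorem winProbAt_eq_trace (hn : Even n) (S : Strategy.{u} n A) (a : A) :
    winProbAt r S a = ((2 : ℝ) ^ n)⁻¹ *
      (gameOp (labelledCosetState r a) (S.bob a) (S.charlie a) * choi S.split).trace.re := by
  have hcard : (Fintype.card (Bits (n / 2)) : ℝ) * Fintype.card (Bits (n / 2)) = 2 ^ n := by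
    rw [Fintype.card_fun, ZMod.card, Fintype.card_fin]
    push_cast
    rw [← pow_add, ← two_mul, Nat.two_mul_div_two_of_even hn]
  have h : ∀ t t', ((S.bob a t ⊗ₖ S.charlie a t t') *
      S.split (ketbra (labelledCosetState r a t t'))).trace =
      ((ketbra (labelledCosetState r a t t') ⊗ₖ (S.bob a t ⊗ₖ S.charlie a t t')) *
        choi S.split).trace :=
    fun t t' => trace_mul_apply_ketbra _ _ (star_cosetState _ _ _)
  simp only [winProbAt, h, Fintype.expect_eq_sum_div_card, gameOp, Matrix.sum_mul, trace_sum,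
    Complex.re_sum]
  rw [← Finset.sum_div, div_div, hcard, div_eq_inv_mul]

theorem sum_winProbAt_le (hn : Even n) (hr : IsCosetLabelling r) (S : Strategy.{u} n A)
    {I : Type*} [Fintype I] (f : I → A)
    (hf : ∀ i, Module.finrank (ZMod 2) (f i : Submodule (ZMod 2) (Bits n)) = n / 2) {K : ℝ}
    (hK : 0 ≤ K)
    (hrow : ∀ i, ∑ j, Real.sqrt ((Nat.card (f i ⊓ f j : Submodule (ZMod 2) (Bits n)) : ℝ) /
      2 ^ (n / 2)) ≤ K) :
    ∑ i, winProbAt r S (f i) ≤ K := by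
  classical
  have hperp : ∀ i, Module.finrank (ZMod 2) (perp (f i).1) = n / 2 := by
    intro i
    rw [finrank_perp, hf]
    have := Nat.two_mul_div_two_of_even hn
    omega
  have hle := sum_gameOp_le (ψ := fun i => labelledCosetState r (f i)) (β := fun i => S.bob (f i))
    (γ := fun i => S.charlie (f i)) (fun i => S.bob_isPOVM _) (fun i => S.charlie_isPOVM _)
    (fun i s => sum_ketbra_cosetState (hf i) (hr _ (hperp i)).2 (r (f i) s))
    (c := fun i j => Real.sqrt ((Nat.card (f i ⊓ f j : Submodule (ZMod 2) (Bits n)) : ℝ) /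
      2 ^ (n / 2))) (fun i j => Real.sqrt_nonneg _) (fun i j => by simp only [inf_comm]) ?_ ?_ hK hrow
  · rw [Matrix.le_iff] at hle
    have h := re_trace_mul_nonneg hle S.split_isChannel.choi_posSemidef
    rw [Matrix.sub_mul, trace_sub, Complex.sub_re, sub_nonneg, Matrix.sum_mul, trace_sum,
      Complex.re_sum, smul_mul, Matrix.one_mul, trace_smul, S.split_isChannel.trace_choi] at h
    simp only [winProbAt_eq_trace hn]
    rw [← Finset.mul_sum, inv_mul_le_iff₀ (by positivity)]
    refine h.trans (le_of_eq ?_)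
    rw [Fintype.card_fun, ZMod.card, Fintype.card_fin, Complex.smul_re, smul_eq_mul, mul_comm,
      Complex.natCast_re]
    push_cast
    rfl
  · intro i j s t t' u u' htu
    refine cosetState_dotProduct_diagonal_eq_zero _ (fun h => htu ?_) _ _ _
    refine (hr _ (hf j)).1 ?_
    exact (Submodule.Quotient.eq _).2 h
  · intro i j s t t'
    rw [Real.sq_sqrt (by positivity)]
    have := cosetState_dotProduct_diagonal_le (f i).1 (f j).1 (r (f i) s) (r (f j) t)
      (r (perp (f j)) t')
    rw [natCard_submodule (f j).1, hf] at this
    exact_mod_cast this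

end FamilyBound

/-! ### Averaging over a group. -/

section Averaging

/-- Averaging over a transitive group action turns a bound for all translates of a family into a
bound for the average over the whole space. -/
theorem card_mul_sum_le_of_isPretransitive {G X I : Type*} [Group G] [Finite G] [Fintype X]
    [Fintype I] [MulAction G X] [MulAction.IsPretransitive G X] (F : X → ℝ) (f : I → X) {K : ℝ}
    (h : ∀ g : G, ∑ i, F (g • f i) ≤ K) :
    Fintype.card I * ∑ x, F x ≤ Fintype.card X * K := by
  have := Fintype.ofFinite G
  have hconst : ∀ x y : X, ∑ g : G, F (g • x) = ∑ g : G, F (g • y) := by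
    intro x y
    obtain ⟨k, rfl⟩ := MulAction.exists_smul_eq G x y
    rw [← Equiv.sum_comp (Equiv.mulRight k)]
    simp [mul_smul]
  have htot : ∑ x, ∑ g : G, F (g • x) = Fintype.card G * ∑ x, F x := by
    rw [Finset.sum_comm, Finset.sum_congr rfl fun g _ =>
      show ∑ x, F (g • x) = ∑ x, F x from Equiv.sum_comp (MulAction.toPerm g) F]
    simp
  have hpt : ∀ x : X, Fintype.card X * ∑ g : G, F (g • x) = Fintype.card G * ∑ x, F x := by
    intro x
    rw [← htot, Finset.sum_congr rfl fun y _ => hconst y x]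
    simp
  have hI : ∑ i, ∑ g : G, F (g • f i) ≤ Fintype.card G * K := by
    rw [Finset.sum_comm]
    calc _ ≤ ∑ _g : G, K := Finset.sum_le_sum fun g _ => h g
      _ = _ := by simp
  have hG : (0 : ℝ) < Fintype.card G := by exact_mod_cast Fintype.card_pos
  have h1 : (Fintype.card X : ℝ) * ∑ i, ∑ g : G, F (g • f i) =
      Fintype.card I * (Fintype.card G * ∑ x, F x) := by
    rw [Finset.mul_sum, Finset.sum_congr rfl fun i _ => hpt (f i)]
    simp
  have h2 := mul_le_mul_of_nonneg_left hI (Nat.cast_nonneg (α := ℝ) (Fintype.card X))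
  rw [h1] at h2
  refine le_of_mul_le_mul_left ?_ hG
  calc _ = _ := by ring
    _ ≤ _ := h2
    _ = _ := by ring

end Averaging

/-! ### Binomial estimates. -/

section Counting

open Finset

/-- Sort the sets `T` by `W = T \ S`. Given `W`, the set is determined by `T ∩ S`, of size `m - #W`,
so at most a middle binomial coefficient of them occur; the binomial theorem sums over `W`. -/
theorem sum_pow_card_sdiff_le {α : Type*} [Fintype α] [DecidableEq α] (S : Finset α) (m : ℕ)
    {x : ℝ} (hx : 0 ≤ x) :
    ∑ T ∈ powersetCard m univ, x ^ #(T \ S) ≤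
      (#S).choose (#S / 2) * (1 + x) ^ #Sᶜ := by
  have hmaps : ∀ T ∈ powersetCard m (univ : Finset α), T \ S ∈ (Sᶜ).powerset := fun T _ =>
    mem_powerset.2 fun i hi => mem_compl.2 (mem_sdiff.1 hi).2
  rw [← sum_fiberwise_of_maps_to hmaps]
  have hfib : ∀ W ∈ (Sᶜ).powerset, ∑ T ∈ powersetCard m univ with T \ S = W, x ^ #(T \ S) ≤
      (#S).choose (#S / 2) * x ^ #W := by
    intro W _
    rw [sum_congr rfl fun T hT => by rw [(mem_filter.1 hT).2], sum_const, nsmul_eq_mul]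
    refine mul_le_mul_of_nonneg_right ?_ (pow_nonneg hx _)
    refine Nat.cast_le.2 (le_trans ?_ (Nat.choose_le_middle (m - #W) #S))
    rw [← card_powersetCard]
    refine card_le_card_of_injOn (fun T => T ∩ S) ?_ ?_
    · intro T hT
      simp only [coe_filter, mem_powersetCard, Set.mem_ofPred_eq] at hT
      have := card_sdiff_add_card_inter T S
      rw [hT.2, hT.1.2] at this
      exact mem_coe.2 (mem_powersetCard.2 ⟨inter_subset_right, by
        change #(T ∩ S) = _
        omega⟩)
    · intro T hT T' hT' h
      simp only [coe_filter, Set.mem_ofPred_eq] at hT hT'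
      rw [← sdiff_union_inter T S, ← sdiff_union_inter T' S, hT.2, hT'.2]
      exact congrArg (W ∪ ·) h
  refine (sum_le_sum hfib).trans (le_of_eq ?_)
  rw [← mul_sum]
  congr 1
  have := prod_one_add (f := fun _ : α => x) Sᶜ
  simpa using this.symm

theorem centralBinom_sq_mul_le (j : ℕ) : j.centralBinom ^ 2 * (3 * j + 1) ≤ 16 ^ j := by
  induction j with
  | zero => simp
  | succ j ih =>
    have h := Nat.succ_mul_centralBinom_succ j
    have h1 : ((j + 1) * (j + 1).centralBinom) ^ 2 * (3 * (j + 1) + 1) * (3 * j + 1) ≤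
        (j + 1) ^ 2 * (3 * j + 1) * 16 ^ (j + 1) := by
      rw [h]
      calc _ = (4 * (2 * j + 1) ^ 2 * (3 * j + 4)) * (j.centralBinom ^ 2 * (3 * j + 1)) := by ring
        _ ≤ (4 * (2 * j + 1) ^ 2 * (3 * j + 4)) * 16 ^ j := Nat.mul_le_mul_left _ ih
        _ ≤ (16 * ((j + 1) ^ 2 * (3 * j + 1))) * 16 ^ j := by
            refine Nat.mul_le_mul_right _ ?_
            nlinarith
        _ = _ := by ring
    have h2 : 0 < (j + 1) ^ 2 * (3 * j + 1) := by positivity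
    refine Nat.le_of_mul_le_mul_left ?_ h2
    calc _ = _ := by ring
      _ ≤ _ := h1

/-- The index is shifted because the bound fails at `0`. -/
theorem sixteen_pow_le (j : ℕ) : 16 ^ (j + 1) ≤ 4 * (j + 1) * (j + 1).centralBinom ^ 2 := by
  induction j with
  | zero => simp [Nat.centralBinom]
  | succ j ih =>
    have h := Nat.succ_mul_centralBinom_succ (j + 1)
    have h2 : 0 < j + 2 := by positivity
    refine Nat.le_of_mul_le_mul_left ?_ h2
    calc (j + 2) * 16 ^ (j + 1 + 1) = 16 * (j + 2) * 16 ^ (j + 1) := by ring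
      _ ≤ 16 * (j + 2) * (4 * (j + 1) * (j + 1).centralBinom ^ 2) := Nat.mul_le_mul_left _ ih
      _ = (64 * (j + 2) * (j + 1)) * (j + 1).centralBinom ^ 2 := by ring
      _ ≤ (16 * (2 * (j + 1) + 1) ^ 2) * (j + 1).centralBinom ^ 2 := by
          refine Nat.mul_le_mul_right _ ?_
          nlinarith
      _ = 4 * (2 * (2 * (j + 1) + 1) * (j + 1).centralBinom) ^ 2 := by ring
      _ = 4 * ((j + 1 + 1) * (j + 1 + 1).centralBinom) ^ 2 := by rw [h]
      _ = _ := by ring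

theorem choose_half_sq_mul_le (m : ℕ) : m.choose (m / 2) ^ 2 * (3 * m + 2) ≤ 2 * 4 ^ m := by
  obtain ⟨j, rfl | rfl⟩ := Nat.even_or_odd' m
  · have h := centralBinom_sq_mul_le j
    rw [Nat.mul_div_cancel_left _ two_pos, ← Nat.centralBinom_eq_two_mul_choose, pow_mul]
    norm_num
    linarith
  · have h := centralBinom_sq_mul_le (j + 1)
    have h1 : (j + 1).centralBinom = 2 * (2 * j + 1).choose j := by
      rw [Nat.centralBinom_eq_two_mul_choose]
      have := Nat.choose_succ_succ (2 * j + 1) j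
      rw [Nat.choose_symm_half] at this
      rw [show 2 * (j + 1) = 2 * j + 1 + 1 by ring, this]
      ring
    have h2 : (2 * j + 1) / 2 = j := by omega
    rw [h2, pow_succ 4, pow_mul]
    rw [h1, pow_succ 16] at h
    norm_num at h ⊢
    nlinarith [Nat.zero_le ((2 * j + 1).choose j ^ 2)]

/-- For `m > 0` the two preceding bounds give a squared ratio of at most `8m / (3m + 2) < 8/3`, and
`8/3 < e`. -/
theorem choose_half_mul_two_pow_le (m : ℕ) :
    (m.choose (m / 2) : ℝ) * 2 ^ m ≤ Real.sqrt (Real.exp 1) * m.centralBinom := by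
  have he : (8 / 3 : ℝ) ≤ Real.exp 1 := by
    have := Real.exp_one_gt_d9
    linarith
  rcases m with _ | j
  · have : (1 : ℝ) ≤ Real.sqrt (Real.exp 1) := Real.one_le_sqrt.2 (by linarith)
    simp
  · have h1 := choose_half_sq_mul_le (j + 1)
    have h2 := sixteen_pow_le j
    set m := j + 1 with hm
    refine le_of_sq_le_sq ?_ (by positivity)
    rw [mul_pow, mul_pow, Real.sq_sqrt (Real.exp_pos 1).le]
    have h1' : ((m.choose (m / 2) : ℝ)) ^ 2 * (3 * m + 2) ≤ 2 * 4 ^ m := by exact_mod_cast h1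
    have h2' : (16 : ℝ) ^ m ≤ 4 * m * (m.centralBinom : ℝ) ^ 2 := by exact_mod_cast h2
    have hm0 : (0 : ℝ) < 3 * m + 2 := by positivity
    refine le_of_mul_le_mul_right ?_ hm0
    have h4 : ((2 : ℝ) ^ m) ^ 2 = 4 ^ m := by rw [← pow_mul, mul_comm, pow_mul]; norm_num
    have h16 : (4 : ℝ) ^ m * 4 ^ m = 16 ^ m := by rw [← mul_pow]; norm_num
    calc _ = ((m.choose (m / 2) : ℝ)) ^ 2 * (3 * m + 2) * 4 ^ m := by rw [h4]; ring
      _ ≤ 2 * 4 ^ m * 4 ^ m := mul_le_mul_of_nonneg_right h1' (by positivity)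
      _ = 2 * 16 ^ m := by rw [mul_assoc, h16]
      _ ≤ 2 * (4 * m * (m.centralBinom : ℝ) ^ 2) := by linarith
      _ = 8 / 3 * (m.centralBinom : ℝ) ^ 2 * (3 * m) := by ring
      _ ≤ Real.exp 1 * (m.centralBinom : ℝ) ^ 2 * (3 * m + 2) := by gcongr; linarith

theorem one_add_sqrt_half : 1 + Real.sqrt (1 / 2) = 2 * Real.cos (Real.pi / 8) ^ 2 := by
  have h : Real.sqrt (1 / 2) = Real.sqrt 2 / 2 := by
    rw [Real.sqrt_eq_iff_mul_self_eq (by norm_num) (by positivity)]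
    have := Real.mul_self_sqrt (show (0 : ℝ) ≤ 2 by norm_num)
    linarith
  rw [h, Real.cos_pi_div_eight, div_pow, Real.sq_sqrt (by positivity)]
  ring

end Counting

/-! ### Register subspaces and the action of the general linear group. -/

section Registers

variable {n : ℕ}

/-- The subspace spanned by the canonical basis vectors indexed by `S`. -/
def registerSubspace (S : Finset (Fin n)) : Submodule (ZMod 2) (Bits n) :=
  Submodule.span (ZMod 2) ((fun i => (Pi.single i 1 : Bits n)) '' (S : Set (Fin n)))

theorem mem_registerSubspace {S : Finset (Fin n)} {v : Bits n} :
    v ∈ registerSubspace S ↔ ∀ i, v i ≠ 0 → i ∈ S := by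
  have h := (Pi.basisFun (ZMod 2) (Fin n)).mem_span_image (m := v) (s := (S : Set (Fin n)))
  have hb : (fun i => (Pi.single i 1 : Bits n)) = Pi.basisFun (ZMod 2) (Fin n) := by
    ext i : 1
    rw [Pi.basisFun_apply]
  rw [registerSubspace, hb, h]
  simp [Set.subset_def]

theorem finrank_registerSubspace (S : Finset (Fin n)) :
    Module.finrank (ZMod 2) (registerSubspace S) = S.card := by
  have h := (Pi.basisFun (ZMod 2) (Fin n)).linearIndependent.comp
    (Subtype.val : S → Fin n) Subtype.val_injective
  have h' := finrank_span_eq_card h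
  rw [Fintype.card_coe, Set.range_comp] at h'
  rw [← h', registerSubspace]
  rw [Subtype.range_coe_subtype, Set.image_congr fun i _ => Pi.basisFun_apply (ZMod 2) _ i]
  rfl

theorem registerSubspace_injective :
    Function.Injective (registerSubspace : Finset (Fin n) → Submodule (ZMod 2) (Bits n)) := by
  intro S T h
  ext i
  have h1 : ∀ U : Finset (Fin n), (Pi.single i 1 : Bits n) ∈ registerSubspace U ↔ i ∈ U := by
    intro U
    rw [mem_registerSubspace]
    simp [Pi.single_apply]
  rw [← h1, h, h1]

theorem registerSubspace_inf (S T : Finset (Fin n)) :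
    registerSubspace S ⊓ registerSubspace T = registerSubspace (S ∩ T) := by
  ext v
  simp only [Submodule.mem_inf, mem_registerSubspace, Finset.mem_inter]
  grind

theorem isRegisterSubspace_iff {a : Submodule (ZMod 2) (Bits n)} :
    IsRegisterSubspace a ↔ ∃ S, registerSubspace S = a := by
  constructor
  · rintro ⟨S, rfl⟩
    exact ⟨(Set.toFinite S).toFinset, by simp [registerSubspace]⟩
  · rintro ⟨S, rfl⟩
    exact ⟨S, rfl⟩

theorem mem_halfSubspaces {a : Submodule (ZMod 2) (Bits n)} :
    a ∈ halfSubspaces n ↔ Module.finrank (ZMod 2) a = n / 2 := by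
  simp [halfSubspaces]

theorem mem_registerHalfSubspaces {a : Submodule (ZMod 2) (Bits n)} :
    a ∈ registerHalfSubspaces n ↔
      ∃ S ∈ Finset.powersetCard (n / 2) Finset.univ, registerSubspace S = a := by
  simp only [registerHalfSubspaces, Set.Finite.mem_toFinset, Set.mem_ofPred_eq,
    isRegisterSubspace_iff, Finset.mem_powersetCard_univ]
  constructor
  · rintro ⟨⟨S, rfl⟩, h⟩
    exact ⟨S, (finrank_registerSubspace S).symm.trans h, rfl⟩
  · rintro ⟨S, h, rfl⟩
    exact ⟨⟨S, rfl⟩, (finrank_registerSubspace S).trans h⟩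

theorem finrank_map_registerSubspace (g : Bits n ≃ₗ[ZMod 2] Bits n) (S : Finset (Fin n)) :
    Module.finrank (ZMod 2) ((registerSubspace S).map (g : Bits n →ₗ[ZMod 2] Bits n)) = S.card :=
  (g.finrank_map_eq _).trans (finrank_registerSubspace S)

/-- The row sum that controls the game over the images of all register subspaces under `g`. -/
theorem sum_sqrt_card_inf_registerSubspace_le (hn : Even n) (g : Bits n ≃ₗ[ZMod 2] Bits n)
    {S : Finset (Fin n)} (hS : S.card = n / 2) :
    ∑ T ∈ Finset.powersetCard (n / 2) Finset.univ,
      Real.sqrt ((Nat.card ((registerSubspace S).map (g : Bits n →ₗ[ZMod 2] Bits n) ⊓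
        (registerSubspace T).map (g : Bits n →ₗ[ZMod 2] Bits n) :
          Submodule (ZMod 2) (Bits n)) : ℝ) / 2 ^ (n / 2)) ≤
      ((n / 2).choose (n / 2 / 2) : ℝ) * (1 + Real.sqrt (1 / 2)) ^ (n / 2) := by
  have h := sum_pow_card_sdiff_le S (n / 2) (Real.sqrt_nonneg (1 / 2))
  have hc : Sᶜ.card = n / 2 := by
    rw [Finset.card_compl, Fintype.card_fin, hS]
    have := Nat.two_mul_div_two_of_even hn
    omega
  rw [hS, hc] at h
  -- As `T` has `n / 2` elements, the overlap is `2 ^ (-|T \ S|)`, whatever `g` is.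
  refine le_trans (le_of_eq (Finset.sum_congr rfl fun T hT => ?_)) h
  have hT' := Finset.mem_powersetCard_univ.1 hT
  have hk := Finset.card_sdiff_add_card_inter T S
  rw [hT', Finset.inter_comm] at hk
  rw [← Submodule.map_inf _ g.injective, registerSubspace_inf, natCard_submodule,
    finrank_map_registerSubspace, ← hk, pow_add]
  push_cast
  rw [div_mul_cancel_right₀ (by positivity), ← one_div, ← _root_.one_div_pow]
  rw [Real.sqrt_eq_iff_mul_self_eq (by positivity) (by positivity), ← mul_pow,
    Real.mul_self_sqrt (by norm_num)]

/-- Glue an isomorphism `a ≃ b` to one between complements; this makes the action on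
half-dimensional subspaces transitive. -/
theorem exists_linearEquiv_map_eq {a b : Submodule (ZMod 2) (Bits n)}
    (h : Module.finrank (ZMod 2) a = Module.finrank (ZMod 2) b) :
    ∃ g : Bits n ≃ₗ[ZMod 2] Bits n, a.map (g : Bits n →ₗ[ZMod 2] Bits n) = b := by
  obtain ⟨a', ha⟩ := a.exists_isCompl
  obtain ⟨b', hb⟩ := b.exists_isCompl
  have h' : Module.finrank (ZMod 2) a' = Module.finrank (ZMod 2) b' := by
    have h1 := Submodule.finrank_add_eq_of_isCompl ha
    have h2 := Submodule.finrank_add_eq_of_isCompl hb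
    omega
  let e := LinearEquiv.ofFinrankEq a b h
  let e' := LinearEquiv.ofFinrankEq a' b' h'
  let g := (Submodule.prodEquivOfIsCompl a a' ha).symm ≪≫ₗ (e.prodCongr e') ≪≫ₗ
    Submodule.prodEquivOfIsCompl b b' hb
  have hg : ∀ v : a, g v = e v := by
    intro v
    simp [g]
  refine ⟨g, Submodule.eq_of_le_of_finrank_eq ?_ ?_⟩
  · rintro _ ⟨v, hv, rfl⟩
    have := hg ⟨v, hv⟩
    exact (congrArg (· ∈ b) this).mpr (e ⟨v, hv⟩).2
  · exact (g.finrank_map_eq a).trans h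

/-- The general linear group acts on the subspaces of half dimension. -/
instance : MulAction (Bits n ≃ₗ[ZMod 2] Bits n) (halfSubspaces n) where
  smul g a := ⟨a.1.map (g : Bits n →ₗ[ZMod 2] Bits n),
    mem_halfSubspaces.2 ((g.finrank_map_eq _).trans (mem_halfSubspaces.1 a.2))⟩
  one_smul _ := Subtype.ext (Submodule.map_id _)
  mul_smul _ _ _ := Subtype.ext (Submodule.map_comp _ _ _)

instance : MulAction.IsPretransitive (Bits n ≃ₗ[ZMod 2] Bits n) (halfSubspaces n) where
  exists_smul_eq a b := by
    obtain ⟨g, hg⟩ := exists_linearEquiv_map_eq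
      ((mem_halfSubspaces.1 a.2).trans (mem_halfSubspaces.1 b.2).symm)
    exact ⟨g, Subtype.ext hg⟩

end Registers

/-! ### The final bound. -/

section Bound

variable {n : ℕ} {A : Finset (Submodule (ZMod 2) (Bits n))}
  {r : Submodule (ZMod 2) (Bits n) → (Bits (n / 2) →ₗ[ZMod 2] Bits n)}

theorem sum_winProbAt_registerSubspace_le (hn : Even n) (hr : IsCosetLabelling r)
    (S : Strategy.{u} n A) (g : Bits n ≃ₗ[ZMod 2] Bits n)
    (f : Finset.powersetCard (n / 2) (Finset.univ : Finset (Fin n)) → A)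
    (hf : ∀ T, (f T : Submodule (ZMod 2) (Bits n)) =
      (registerSubspace T.1).map (g : Bits n →ₗ[ZMod 2] Bits n)) :
    ∑ T, winProbAt r S (f T) ≤
      ((n / 2).choose (n / 2 / 2) : ℝ) * (1 + Real.sqrt (1 / 2)) ^ (n / 2) := by
  refine sum_winProbAt_le hn hr S f (fun T => ?_) (by positivity) (fun T => ?_)
  · rw [hf, finrank_map_registerSubspace]
    exact Finset.mem_powersetCard_univ.1 T.2
  · simp only [hf]
    have h := sum_sqrt_card_inf_registerSubspace_le hn g (Finset.mem_powersetCard_univ.1 T.2)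
    rw [← Finset.sum_coe_sort] at h
    exact h

theorem card_mul_sum_winProbAt_le (hn : Even n)
    (hA : A = registerHalfSubspaces n ∨ A = halfSubspaces n) (hr : IsCosetLabelling r)
    (S : Strategy.{u} n A) :
    (n.choose (n / 2) : ℝ) * ∑ a, winProbAt r S a ≤ Fintype.card A *
      (((n / 2).choose (n / 2 / 2) : ℝ) * (1 + Real.sqrt (1 / 2)) ^ (n / 2)) := by
  have hcard : Fintype.card (Finset.powersetCard (n / 2) (Finset.univ : Finset (Fin n))) =
      n.choose (n / 2) := by simp
  rcases hA with rfl | rfl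
  · let f : Finset.powersetCard (n / 2) (Finset.univ : Finset (Fin n)) →
        registerHalfSubspaces n :=
      fun T => ⟨registerSubspace T.1, mem_registerHalfSubspaces.2 ⟨T.1, T.2, rfl⟩⟩
    have hf : Function.Bijective f := by
      constructor
      · intro T U h
        exact Subtype.ext (registerSubspace_injective (congrArg Subtype.val h))
      · intro a
        obtain ⟨T, hT, h⟩ := mem_registerHalfSubspaces.1 a.2
        exact ⟨⟨T, hT⟩, Subtype.ext h⟩
    rw [← hcard, Fintype.card_of_bijective hf, ← hf.sum_comp]
    refine mul_le_mul_of_nonneg_left ?_ (Nat.cast_nonneg _)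
    exact sum_winProbAt_registerSubspace_le hn hr S (LinearEquiv.refl _ _) f
      fun T => (Submodule.map_id _).symm
  · have : Finite (Bits n ≃ₗ[ZMod 2] Bits n) := DFunLike.finite _
    let f : Finset.powersetCard (n / 2) (Finset.univ : Finset (Fin n)) → halfSubspaces n :=
      fun T => ⟨registerSubspace T.1, mem_halfSubspaces.2
        ((finrank_registerSubspace _).trans (Finset.mem_powersetCard_univ.1 T.2))⟩
    rw [← hcard]
    exact card_mul_sum_le_of_isPretransitive (G := Bits n ≃ₗ[ZMod 2] Bits n) _ f
      fun g => sum_winProbAt_registerSubspace_le hn hr S g (fun T => g • f T) fun T => rfl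

theorem winProb_le (hn : Even n)
    (hA : A = registerHalfSubspaces n ∨ A = halfSubspaces n) (hr : IsCosetLabelling r)
    (S : Strategy.{u} n A) :
    winProb r S ≤ Real.sqrt (Real.exp 1) * Real.cos (Real.pi / 8) ^ n := by
  have h1 := card_mul_sum_winProbAt_le hn hA hr S
  have h2 := choose_half_mul_two_pow_le (n / 2)
  have hnn := Nat.two_mul_div_two_of_even hn
  rw [Nat.centralBinom_eq_two_mul_choose, hnn] at h2
  have hwin : winProb r S = (∑ a, winProbAt r S a) / Fintype.card A :=
    Fintype.expect_eq_sum_div_card _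
  rw [hwin]
  generalize ∑ a, winProbAt r S a = w at h1 ⊢
  have hcos : Real.cos (Real.pi / 8) ^ n = (Real.cos (Real.pi / 8) ^ 2) ^ (n / 2) := by
    rw [← pow_mul, hnn]
  rw [one_add_sqrt_half, mul_pow, ← mul_assoc, ← hcos] at h1
  have hcospos : 0 ≤ Real.cos (Real.pi / 8) ^ n := by
    rw [hcos]
    positivity
  have hC : (0 : ℝ) < n.choose (n / 2) := by
    exact_mod_cast Nat.choose_pos (Nat.div_le_self n 2)
  have h3 : w ≤ Fintype.card A * (Real.sqrt (Real.exp 1) * Real.cos (Real.pi / 8) ^ n) := by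
    refine le_of_mul_le_mul_left (h1.trans ?_) hC
    calc _ ≤ Fintype.card A * (Real.sqrt (Real.exp 1) * n.choose (n / 2) *
            Real.cos (Real.pi / 8) ^ n) := by
          rw [mul_assoc, ← mul_assoc _ ((2 : ℝ) ^ (n / 2))]
          gcongr
      _ = _ := by ring
  exact div_le_of_le_mul₀ (Nat.cast_nonneg _)
    (mul_nonneg (Real.sqrt_nonneg _) hcospos) (h3.trans_eq (mul_comm _ _))

end Bound

end LeakyMoE

theorem mainTheorem1 (n : ℕ) (hn : Even n)
    (A : Finset (Submodule (ZMod 2) (LeakyMoE.Bits n)))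
    (hA : A = LeakyMoE.registerHalfSubspaces n ∨ A = LeakyMoE.halfSubspaces n)
    (r : Submodule (ZMod 2) (LeakyMoE.Bits n) →
      (LeakyMoE.Bits (n / 2) →ₗ[ZMod 2] LeakyMoE.Bits n))
    (hr : LeakyMoE.IsCosetLabelling r) :
    BddAbove (Set.range (fun S : LeakyMoE.Strategy.{u} n A => LeakyMoE.winProb r S)) ∧
      LeakyMoE.optWinProb.{u} A r ≤
        Real.sqrt (Real.exp 1) * Real.cos (Real.pi / 8) ^ n := by
  -- Boundedness ensures that the real `⨆` is a genuine supremum and not the default value `0`.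
  refine ⟨⟨_, Set.forall_mem_range.2 (LeakyMoE.winProb_le hn hA hr)⟩, ?_⟩
  exact Real.iSup_le (LeakyMoE.winProb_le hn hA hr)
    (mul_nonneg (Real.sqrt_nonneg _) (hn.pow_nonneg _))
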